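/- Let $\mathbb{H}$ be the upper half-plane, let $W_5=\begin{pmatrix}0&-1/\sqrt5\\ \sqrt5&0\end{pmatrix}$, and let $\Gamma_0^*(5)=\Gamma_0(5)\cup\Gamma_0(5)W_5\subset \mathrm{SL}_2(\mathbb{R})$ be the Fricke group. For an integer $k$ let $M^*_{k,5}$ be the complex vector space of (holomorphic) modular forms of weight $k$ for $\Gamma_0^*(5)$ and let $M^{*0}_{k,5}\subset M^*_{k,5}$ be the subspace of cusp forms. For even $k\ge 4$ let $$E_k(z)=\frac12\sum_{\substack{(c,d)\in\mathbb{Z}^2\\ \gcd(c,d)=1}}(cz+d)^{-k},$$ put $E_0=1$, and for $k=0$ and even $k\geq 4$ let $$E^*_{k,5}(z)=\frac{1}{5^{k/2}+1}\bigl(5^{k/2}E_k(5z)+E_k(z)\bigr)\qquad(z\in\mathbb{H}),$$ so that $E^*_{0,5}=1$. Let $\Delta_5(z)=\eta(z)^4\,\eta(5z)^4$, where $\eta$ is the Dedekind eta function. **Theorem.** Let $k$ be an even integer. 1. If $k<0$ or $k=2$, then $M^*_{k,5}=0$. 2. If $k=0$ or $k=6$, then $M^{*0}_{k,5}=0$,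 and $M^*_{k,5}$ is one-dimensional with basis $E^*_{k,5}$. 3. $M^{*0}_{k,5}=\Delta_5\,M^*_{k-4,5}$, that is, the cusp forms of weight $k$ for $\Gamma_0^*(5)$ are exactly the functions $\Delta_5\, g$ with $g\in M^*_{k-4,5}$. -/

import Mathlib

open Matrix Matrix.SpecialLinearGroup CongruenceSubgroup UpperHalfPlane
open scoped MatrixGroups

noncomputable section

namespace Fricke

/-- The Fricke involution matrix `W_p = (0, -1/√p; √p, 0)`, of determinant one. -/
def W (p : ℕ) [NeZero p] : GL (Fin 2) ℝ :=
  GeneralLinearGroup.mkOfDetNeZero !![0, -1 / √(p : ℝ); √(p : ℝ), 0] (by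
    have h : √(p : ℝ) ≠ 0 :=
      (Real.sqrt_pos.2 (Nat.cast_pos.2 (Nat.pos_of_neZero p))).ne'
    simp [h])

theorem W_coe (p : ℕ) [NeZero p] :
    (W p : Matrix (Fin 2) (Fin 2) ℝ) = !![0, -1 / √(p : ℝ); √(p : ℝ), 0] := rfl

theorem det_W (p : ℕ) [NeZero p] : (W p).det = 1 := by
  have h : √(p : ℝ) ≠ 0 := (Real.sqrt_pos.2 (Nat.cast_pos.2 (Nat.pos_of_neZero p))).ne'
  ext
  simp [W_coe, h]

/-- `W_p² = -1`, where `-1` is viewed as an element of `Γ₀(p)`. -/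
theorem W_mul_W (p : ℕ) [NeZero p] : W p * W p = mapGL ℝ (-1 : SL(2, ℤ)) := by
  have h : √(p : ℝ) ≠ 0 := (Real.sqrt_pos.2 (Nat.cast_pos.2 (Nat.pos_of_neZero p))).ne'
  ext i j
  fin_cases i <;> fin_cases j <;> simp [W_coe, h, mul_div_cancel₀]

/-- `W_p` normalises `Γ₀(p)`. -/
theorem W_conj (p : ℕ) [NeZero p] {γ : SL(2, ℤ)} (hγ : γ ∈ Gamma0 p) :
    ∃ δ ∈ Gamma0 p, W p * mapGL ℝ γ = mapGL ℝ δ * W p := by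
  have hp : 0 < (p : ℝ) := Nat.cast_pos.2 (Nat.pos_of_neZero p)
  have h : √(p : ℝ) ≠ 0 := (Real.sqrt_pos.2 hp).ne'
  have hs : √(p : ℝ) * √(p : ℝ) = p := Real.mul_self_sqrt hp.le
  rw [Gamma0_mem, ZMod.intCast_zmod_eq_zero_iff_dvd] at hγ
  obtain ⟨c, hc⟩ := hγ
  have hd := γ.det_coe
  rw [Matrix.det_fin_two, hc] at hd
  obtain ⟨δ, h00, h01, h10, h11⟩ : ∃ δ : SL(2, ℤ),
      δ 0 0 = γ 1 1 ∧ δ 0 1 = -c ∧ δ 1 0 = -(p * γ 0 1) ∧ δ 1 1 = γ 0 0 :=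
    ⟨⟨!![γ 1 1, -c; -(p * γ 0 1), γ 0 0], by rw [Matrix.det_fin_two_of]; linarith⟩,
      rfl, rfl, rfl, rfl⟩
  refine ⟨δ, ?_, ?_⟩
  · rw [Gamma0_mem, h10]
    simp
  · ext i j
    fin_cases i <;> fin_cases j <;>
      simp [W_coe, Matrix.mul_apply, Fin.sum_univ_two, h00, h01, h10, h11, hc]
    · field_simp
      linear_combination (c : ℝ) * hs
    · field_simp
    · ring
    · field_simp
      linear_combination (γ 0 1 : ℝ) * hs

/-- The Fricke group `Γ₀*(p) = Γ₀(p) ∪ Γ₀(p) W_p`, as a subgroup of `GL₂(ℝ)`. -/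
def Gamma0Star (p : ℕ) [NeZero p] : Subgroup (GL (Fin 2) ℝ) where
  carrier := {g | ∃ γ ∈ Gamma0 p, g = mapGL ℝ γ ∨ g = mapGL ℝ γ * W p}
  one_mem' := ⟨1, one_mem _, Or.inl (by simp)⟩
  mul_mem' := by
    rintro _ _ ⟨γ, hγ, rfl | rfl⟩ ⟨δ, hδ, rfl | rfl⟩
    · exact ⟨γ * δ, mul_mem hγ hδ, Or.inl (by simp)⟩
    · exact ⟨γ * δ, mul_mem hγ hδ, Or.inr (by simp [mul_assoc])⟩
    · obtain ⟨ε, hε, h⟩ := W_conj p hδ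
      exact ⟨γ * ε, mul_mem hγ hε, Or.inr (by rw [mul_assoc, h, map_mul, mul_assoc])⟩
    · obtain ⟨ε, hε, h⟩ := W_conj p hδ
      refine ⟨γ * ε * (-1), mul_mem (mul_mem hγ hε) (by simp [Gamma0_mem]), Or.inl ?_⟩
      rw [map_mul, ← W_mul_W p, map_mul, mul_assoc, ← mul_assoc (W p), h]
      simp only [mul_assoc]
  inv_mem' := by
    rintro _ ⟨γ, hγ, rfl | rfl⟩
    · exact ⟨γ⁻¹, inv_mem hγ, Or.inl (by simp)⟩
    · obtain ⟨ε, hε, h⟩ := W_conj p (inv_mem hγ)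
      have hW : (W p)⁻¹ = mapGL ℝ (-1 : SL(2, ℤ)) * W p := by
        rw [inv_eq_iff_mul_eq_one, ← W_mul_W p, ← mul_assoc, ← mul_assoc, W_mul_W p, mul_assoc,
          W_mul_W p, ← map_mul]
        simp
      refine ⟨-1 * ε, mul_mem (by simp [Gamma0_mem]) hε, Or.inr ?_⟩
      rw [_root_.mul_inv_rev, hW, ← map_inv, mul_assoc, h, map_mul, mul_assoc]

instance (p : ℕ) [NeZero p] : (Gamma0Star p).HasDetOne where
  det_eq := by
    rintro _ ⟨γ, -, rfl | rfl⟩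
    · simp
    · simp [det_W]

/-- The normalised Eisenstein series of weight `k` for `SL₂(ℤ)`,
`E_k(z) = (1/2) ∑_{(c,d)=1} (cz+d)^{-k}` (for even `k ≥ 4`), with the convention `E_0 = 1`. -/
def E (k : ℤ) (z : ℍ) : ℂ :=
  if k = 0 then 1
  else 1 / 2 * eisensteinSeries (N := 1) 0 k z

/-- The point `p z` of the upper half-plane. -/
def scale (p : ℕ) [NeZero p] (z : ℍ) : ℍ :=
  ⟨(p : ℂ) * z, by
    have := mul_pos (Nat.cast_pos (α := ℝ).2 (Nat.pos_of_neZero p)) z.im_pos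
    simpa using this⟩

/-- The Eisenstein series
`E*_{k,p}(z) = (p^{k/2} E_k(pz) + E_k(z)) / (p^{k/2} + 1)` for `Γ₀*(p)` (`k` even). -/
def EStar (p : ℕ) [NeZero p] (k : ℤ) (z : ℍ) : ℂ :=
  1 / ((p : ℂ) ^ (k / 2) + 1) * ((p : ℂ) ^ (k / 2) * E k (scale p z) + E k z)

/-- `Δ₅(z) = η(z)⁴ η(5z)⁴`, with `η` the Dedekind eta function. -/
def Delta5 (z : ℍ) : ℂ :=
  ModularForm.eta z ^ 4 * ModularForm.eta (5 * z) ^ 4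

end Fricke

end

/-! Everything rests on `Delta5`: it has weight four with trivial character, has no zero on the
upper half-plane, and vanishes to order exactly one at infinity, which represents the only cusp. A
cusp form is therefore divisible by it, and the quotient is a modular form of weight `k - 4`; this
is part 3.

Since negative weights carry no forms, there are no cusp forms of weight 0 or 2, and a form of such
weight is determined by its constant term. In weight 0 this leaves the constants. In weight 2 the
constant term is shown to vanish: it is the increment under `z ↦ z + 1` of a primitive `F` of `f`.
As `f dz` is invariant, `F` changes by a constant under each group element, and by zero under one
with a fixed point in the upper half-plane; translation is a product of such elements. So weight 2
is zero, weight 6 has no cusp forms, and `EStar 5 6`, with constant term one, spans weight 6.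

The character of `Delta5` is trivial because its sixth power is `Δ(z) Δ(5z)`, leaving only sixth
roots of unity on `Γ₀(5)`, and these are checked on generators (`Gamma0_five_le`). -/

namespace Fricke

/-! ### The Fricke group: arithmeticity and cusps. -/

section Group

variable {p : ℕ} [NeZero p]

theorem mapGL_mem_Gamma0Star {γ : SL(2, ℤ)} (hγ : γ ∈ Gamma0 p) :
    mapGL ℝ γ ∈ Gamma0Star p :=
  ⟨γ, hγ, Or.inl rfl⟩

theorem W_mem_Gamma0Star : W p ∈ Gamma0Star p :=
  ⟨1, one_mem _, Or.inr (by simp)⟩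

instance isArithmetic_Gamma0Star : (Gamma0Star p).IsArithmetic := by
  let G : Subgroup (GL (Fin 2) ℝ) := (Gamma0 p).map (mapGL ℝ)
  have hle : G ≤ Gamma0Star p := by
    rintro _ ⟨γ, hγ, rfl⟩
    exact mapGL_mem_Gamma0Star hγ
  let w : Gamma0Star p := ⟨(W p)⁻¹, inv_mem W_mem_Gamma0Star⟩
  -- `Γ₀(p)` has at most two cosets, those of `1` and `W⁻¹`.
  have hsurj : Function.Surjective
      (fun b : Bool ↦ ((if b then 1 else w : Gamma0Star p) :
        Gamma0Star p ⧸ G.subgroupOf (Gamma0Star p))) := by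
    intro q
    induction q using QuotientGroup.induction_on with | H x =>
    obtain ⟨δ, hδ, h | h⟩ := inv_mem x.2
    · refine ⟨true, QuotientGroup.eq.2 ?_⟩
      have : (x : GL (Fin 2) ℝ) = mapGL ℝ δ⁻¹ := by rw [map_inv, ← h, inv_inv]
      exact Subgroup.mem_subgroupOf.2 ⟨δ⁻¹, inv_mem hδ, by simp [this]⟩
    · refine ⟨false, QuotientGroup.eq.2 ?_⟩
      have : (x : GL (Fin 2) ℝ) = (W p)⁻¹ * mapGL ℝ δ⁻¹ := by
        rw [map_inv, ← _root_.mul_inv_rev, ← h, inv_inv]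
      exact Subgroup.mem_subgroupOf.2 ⟨δ⁻¹, inv_mem hδ, by simp [this, w]⟩
  have hfin : Finite (Gamma0Star p ⧸ G.subgroupOf (Gamma0Star p)) := .of_surjective _ hsurj
  have hcomm : (Gamma0Star p).Commensurable G :=
    ⟨by simp [Subgroup.relIndex_eq_one.2 hle], Subgroup.index_ne_zero_of_finite⟩
  exact ⟨hcomm.trans (Subgroup.IsArithmetic.is_commensurable (𝒢 := G))⟩

omit [NeZero p] in
theorem T_mem_Gamma0 : ModularGroup.T ∈ Gamma0 p := by
  simp [Gamma0_mem, ModularGroup.coe_T]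

theorem one_mem_strictPeriods_Gamma0Star : (1 : ℝ) ∈ (Gamma0Star p).strictPeriods := by
  rw [Subgroup.mem_strictPeriods_iff]
  convert mapGL_mem_Gamma0Star (T_mem_Gamma0 (p := p)) using 1
  ext i j
  fin_cases i <;> fin_cases j <;> simp [ModularGroup.coe_T]

/-- For a prime `p`, the Fricke group has a single class of cusps. -/
theorem exists_smul_infty_eq_of_isCusp (hp : p.Prime) {c : OnePoint ℝ}
    (hc : IsCusp c (Gamma0Star p)) : ∃ g ∈ Gamma0Star p, g • OnePoint.infty = c := by
  rw [Subgroup.IsArithmetic.isCusp_iff_isCusp_SL2Z, isCusp_SL2Z_iff'] at hc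
  obtain ⟨γ, rfl⟩ := hc
  by_cases h : (p : ℤ) ∣ γ 1 0
  · exact ⟨_, mapGL_mem_Gamma0Star (by rwa [Gamma0_mem, ZMod.intCast_zmod_eq_zero_iff_dvd]), rfl⟩
  have hcop : IsCoprime (γ 1 0) (p * γ 0 0) := by
    refine IsCoprime.mul_right ?_ ?_
    · exact ((Nat.prime_iff_prime_int.1 hp).coprime_iff_not_dvd.2 h).symm
    · have := γ.det_coe
      rw [Matrix.det_fin_two] at this
      exact ⟨-γ 0 1, γ 1 1, by linarith⟩
  obtain ⟨x, y, hxy⟩ := hcop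
  -- `W` sends infinity to 0, and `δ` sends 0 to the ratio of its second column, which is chosen to
  -- be the first column of `γ`.
  obtain ⟨δ, hδ⟩ : ∃ δ : SL(2, ℤ),
      (δ : Matrix (Fin 2) (Fin 2) ℤ) = !![x, γ 0 0; -(p * y), γ 1 0] :=
    ⟨⟨_, by rw [Matrix.det_fin_two_of]; linarith⟩, rfl⟩
  refine ⟨mapGL ℝ δ * W p, ⟨δ, by simp [Gamma0_mem, hδ], Or.inr rfl⟩, ?_⟩
  have hs : √(p : ℝ) ≠ 0 := (Real.sqrt_pos.2 (Nat.cast_pos.2 (Nat.pos_of_neZero p))).ne'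
  have h10 : (γ 1 0 : ℝ) ≠ 0 := by
    intro h0
    exact h (by simp [Int.cast_eq_zero.1 h0])
  rw [OnePoint.smul_infty_eq_ite, OnePoint.smul_infty_eq_ite]
  simp [W_coe, Matrix.mul_apply, Fin.sum_univ_two, hδ, hs, h10, mul_div_mul_right]

end Group

/-! ### Cusp conditions reduced to infinity. -/

section Cusp

variable {p : ℕ} [NeZero p] {k : ℤ} {f : ℍ → ℂ}

open scoped ModularForm

theorem isBoundedAt_of_isBoundedAtImInfty (hp : p.Prime)
    (hf : ∀ g ∈ Gamma0Star p, f ∣[k] g = f) (hb : IsBoundedAtImInfty f) {c : OnePoint ℝ}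
    (hc : IsCusp c (Gamma0Star p)) : c.IsBoundedAt f k := by
  obtain ⟨g, hg, hgc⟩ := exists_smul_infty_eq_of_isCusp hp hc
  rwa [OnePoint.isBoundedAt_iff hgc, hf g hg]

theorem isZeroAt_of_isZeroAtImInfty (hp : p.Prime)
    (hf : ∀ g ∈ Gamma0Star p, f ∣[k] g = f) (hb : IsZeroAtImInfty f) {c : OnePoint ℝ}
    (hc : IsCusp c (Gamma0Star p)) : c.IsZeroAt f k := by
  obtain ⟨g, hg, hgc⟩ := exists_smul_infty_eq_of_isCusp hp hc
  rwa [OnePoint.isZeroAt_iff hgc, hf g hg]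

end Cusp

/-! ### Generators of `Γ₀(5)`. -/

section Generators

/-- `Γ₀(5)` is generated by `T`, a lower unipotent matrix and two elements of order four. -/
theorem Gamma0_five_le {H : Subgroup SL(2, ℤ)} {V e₁ e₂ : SL(2, ℤ)}
    (hV : (V : Matrix (Fin 2) (Fin 2) ℤ) = !![1, 0; 5, 1])
    (he₁ : (e₁ : Matrix (Fin 2) (Fin 2) ℤ) = !![2, -1; 5, -2])
    (he₂ : (e₂ : Matrix (Fin 2) (Fin 2) ℤ) = !![-2, -1; 5, 2])
    (hTH : ModularGroup.T ∈ H) (hVH : V ∈ H) (he₁H : e₁ ∈ H) (he₂H : e₂ ∈ H) :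
    Gamma0 5 ≤ H := by
  have hneg : (-1 : SL(2, ℤ)) ∈ H := by
    convert mul_mem he₁H he₁H using 1
    ext i j
    fin_cases i <;> fin_cases j <;> simp [he₁]
  suffices ∀ n : ℕ, ∀ γ : SL(2, ℤ), ∀ c : ℤ, γ 1 0 = 5 * c → c.natAbs = n → γ ∈ H by
    intro γ hγ
    rw [Gamma0_mem, ZMod.intCast_zmod_eq_zero_iff_dvd] at hγ
    obtain ⟨c, hc⟩ := hγ
    exact this _ γ c (by simpa using hc) rfl
  intro n
  -- Descent on `|c|`, where `5c` is the lower left entry; a power of `T` first brings the lower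
  -- right entry `d` into the range `2|d| ≤ 5|c|`.
  induction n using Nat.strong_induction_on with | _ n ih =>
  have key : ∀ γ : SL(2, ℤ), ∀ c : ℤ, γ 1 0 = 5 * c → c.natAbs = n → 2 * |γ 1 1| ≤ 5 * |c| →
      c ≠ 0 → γ ∈ H := by
    intro γ c hc hn hle h0
    have hd0 : γ 1 1 ≠ 0 := by
      intro h
      have := γ.det_coe
      rw [Matrix.det_fin_two, h, hc] at this
      have : (5 : ℤ) ∣ 1 := ⟨-(γ 0 1 * c), by linarith⟩
      norm_num at this
    have step : ∀ δ ∈ H, ∀ c' : ℤ, (γ * δ) 1 0 = 5 * c' → |c'| < |c| → γ ∈ H := by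
      intro δ hδ c' hc' hlt
      rw [Int.abs_eq_natAbs, Int.abs_eq_natAbs] at hlt
      have := ih c'.natAbs (by omega) (γ * δ) c' hc' rfl
      exact (Subgroup.mul_mem_cancel_right H hδ).1 this
    have hV' : (γ * V⁻¹) 1 0 = 5 * (c - γ 1 1) := by
      simp [hV, Matrix.mul_apply, Fin.sum_univ_two, hc, Matrix.adjugate_fin_two]; ring
    have hV'' : (γ * V) 1 0 = 5 * (c + γ 1 1) := by
      simp [hV, Matrix.mul_apply, Fin.sum_univ_two, hc]; ring
    have he₁' : (γ * e₁) 1 0 = 5 * (2 * c + γ 1 1) := by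
      simp [he₁, Matrix.mul_apply, Fin.sum_univ_two, hc]; ring
    have he₂' : (γ * e₂) 1 0 = 5 * (-2 * c + γ 1 1) := by
      simp [he₂, Matrix.mul_apply, Fin.sum_univ_two, hc]; ring
    generalize γ 1 1 = d at *
    -- If `0 < |d| < 2|c|`, a factor `V` or its inverse replaces `|c|` by `||c| - |d||`. Otherwise
    -- `2|c| ≤ |d| ≤ 5|c|/2`, and an element of order four replaces it by `|d| - 2|c| ≤ |c|/2`.
    by_cases hsmall : |d| < 2 * |c|
    · by_cases hs : 0 < c * d
      · refine step _ (inv_mem hVH) _ hV' ?_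
        rcases pos_and_pos_or_neg_and_neg_of_mul_pos hs with h | h <;> grind
      · refine step _ hVH _ hV'' ?_
        rcases mul_nonpos_iff.1 (not_lt.1 hs) with h | h <;> grind
    · by_cases hs : 0 < c * d
      · refine step _ he₂H _ he₂' ?_
        rcases pos_and_pos_or_neg_and_neg_of_mul_pos hs with h | h <;> grind
      · refine step _ he₁H _ he₁' ?_
        rcases mul_nonpos_iff.1 (not_lt.1 hs) with h | h <;> grind
  intro γ c hc hn
  by_cases h0 : c = 0
  · have hd := γ.det_coe
    rw [Matrix.det_fin_two, hc, h0] at hd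
    have hTb : ∀ δ : SL(2, ℤ), δ 0 0 = 1 → δ 1 0 = 0 → δ 1 1 = 1 → δ ∈ H := by
      intro δ h00 h10 h11
      have : δ = ModularGroup.T ^ (δ 0 1) := by
        ext i j
        fin_cases i <;> fin_cases j <;> simp [ModularGroup.coe_T_zpow, h00, h10, h11]
      rw [this]
      exact zpow_mem hTH _
    rcases Int.eq_one_or_neg_one_of_mul_eq_one' (show γ 0 0 * γ 1 1 = 1 by linarith) with h | h
    · exact hTb γ h.1 (by simp [hc, h0]) h.2
    · refine (Subgroup.mul_mem_cancel_right H hneg).1 (hTb _ ?_ ?_ ?_)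
      · simp [h.1]
      · simp [hc, h0]
      · simp [h.2]
  · obtain ⟨m, hm⟩ : ∃ m : ℤ, 2 * |γ 1 1 + 5 * c * m| ≤ 5 * |c| := by
      refine ⟨-round ((γ 1 1 : ℚ) / (5 * c)), ?_⟩
      have hc0 : (c : ℚ) ≠ 0 := by exact_mod_cast h0
      have := abs_sub_round ((γ 1 1 : ℚ) / (5 * c))
      have h5 : (0 : ℚ) < |5 * (c : ℚ)| := abs_pos.2 (by simpa using hc0)
      have h2 := mul_le_mul_of_nonneg_right this h5.le
      rw [← abs_mul, sub_mul, div_mul_cancel₀ _ (by simpa using hc0), abs_mul 5,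
        abs_of_pos (by norm_num : (0:ℚ) < 5)] at h2
      have h3 : (2 : ℚ) * |(γ 1 1 : ℚ) + 5 * c * (-round ((γ 1 1 : ℚ) / (5 * c)) : ℤ)| ≤
          5 * |(c : ℚ)| := by
        push_cast
        rw [show (γ 1 1 : ℚ) + 5 * c * (-(round ((γ 1 1 : ℚ) / (5 * c)) : ℚ)) =
          (γ 1 1 : ℚ) - round ((γ 1 1 : ℚ) / (5 * c)) * (5 * c) by ring]
        linarith
      exact_mod_cast h3
    refine (Subgroup.mul_mem_cancel_right H (zpow_mem hTH m)).1 (key _ c ?_ hn ?_ h0)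
    · simp [ModularGroup.coe_T_zpow, Matrix.mul_apply, Fin.sum_univ_two, hc]
    · convert hm using 3
      simp [ModularGroup.coe_T_zpow, Matrix.mul_apply, Fin.sum_univ_two, hc]
      ring

end Generators

end Fricke

namespace Fricke

open scoped ModularForm Real

/-! ### Slash action in determinant one. -/

section Slash

theorem slash_eq_self_iff_of_det_eq_one {f : ℍ → ℂ} {k : ℤ} {g : GL (Fin 2) ℝ}
    (hg : g.det = 1) : f ∣[k] g = f ↔ ∀ z, f (g • z) = denom g z ^ k * f z := by
  rw [funext_iff]
  refine forall_congr' fun z ↦ ?_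
  have hσ : ∀ w, σ g w = w := by simp [σ, hg]
  have hd : denom g z ^ k ≠ 0 := zpow_ne_zero _ (denom_ne_zero g z)
  rw [ModularForm.slash_apply, hσ, hg]
  simp only [Units.val_one, abs_one, Complex.ofReal_one, _root_.one_zpow, mul_one, _root_.zpow_neg]
  rw [mul_inv_eq_iff_eq_mul₀ hd, mul_comm]

theorem coe_smul_of_det_eq_one {g : GL (Fin 2) ℝ} (hg : g.det = 1) (z : ℍ) :
    ((g • z : ℍ) : ℂ) = (g 0 0 * z + g 0 1) / (g 1 0 * z + g 1 1) := by
  rw [coe_smul_of_det_pos (by simp [hg])]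
  simp [num, denom]

/-- The function `z ↦ f (p z)` of a modular form of level one transforms like a modular form
for `Γ₀(p)`. -/
theorem comp_scale_smul {p : ℕ} [NeZero p] {k : ℤ} (f : ModularForm 𝒮ℒ k) {γ : SL(2, ℤ)}
    (hγ : γ ∈ Gamma0 p) (z : ℍ) :
    f (scale p (mapGL ℝ γ • z)) = denom (mapGL ℝ γ) z ^ k * f (scale p z) := by
  rw [Gamma0_mem, ZMod.intCast_zmod_eq_zero_iff_dvd] at hγ
  obtain ⟨c, hc⟩ := hγ
  have hd := γ.det_coe
  rw [Matrix.det_fin_two, hc] at hd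
  -- `δ` is the conjugate of `γ` by `diag(p, 1)`, integral because `p` divides the lower left entry
  -- of `γ`.
  obtain ⟨δ, hδ⟩ : ∃ δ : SL(2, ℤ),
      (δ : Matrix (Fin 2) (Fin 2) ℤ) = !![γ 0 0, p * γ 0 1; c, γ 1 1] :=
    ⟨⟨_, by rw [Matrix.det_fin_two_of]; linarith⟩, rfl⟩
  have hden : denom (mapGL ℝ γ) z = denom (mapGL ℝ δ) (scale p z) := by
    simp [denom, hδ, hc, scale]
    ring
  have hsc : scale p (mapGL ℝ γ • z) = mapGL ℝ δ • scale p z := by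
    have hne := denom_ne_zero (mapGL ℝ δ) (scale p z)
    ext
    rw [coe_smul_of_det_eq_one (by simp)]
    change (p : ℂ) * ((mapGL ℝ γ • z : ℍ) : ℂ) = _
    rw [coe_smul_of_det_eq_one (by simp)]
    have h1 := hden ▸ hne
    simp [denom, hc, hδ, scale] at hne h1 ⊢
    field_simp
  rw [hsc, hden]
  exact SlashInvariantForm.slash_action_eqn'' f (MonoidHom.mem_range.2 ⟨δ, rfl⟩) _

end Slash

/-! ### Invariance of `Δ₅`. -/

section Delta5

open Complex ModularForm Function

theorem eta_neg_one_div_pow_four {w : ℂ} (hw : 0 < w.im) :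
    η (-1 / w) ^ 4 = -w ^ 2 * η w ^ 4 := by
  have h := eta_comp_eq_csqrt_I_inv hw
  have hs : ∀ v : ℂ, v ≠ 0 → sqrt v ^ 4 = v ^ 2 := by
    intro v hv
    rw [sqrt_eq_exp hv, ← exp_nat_mul, show ((4 : ℕ) : ℂ) * (log v / 2) = (2 : ℕ) * log v by
      push_cast; ring, exp_nat_mul, exp_log hv]
  have hw0 : w ≠ 0 := by rintro rfl; simp at hw
  simp only [Function.comp_apply, Pi.smul_apply, Pi.mul_apply, smul_eq_mul] at h
  rw [h, mul_pow, mul_pow, inv_pow, hs Complex.I I_ne_zero, hs w hw0, I_sq]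
  ring

theorem eta_add_one (w : ℂ) : η (w + 1) = cexp (2 * π * Complex.I / 24) * η w := by
  have h1 : Periodic.qParam 1 (w + 1) = Periodic.qParam 1 w := by
    simp only [Periodic.qParam, ← exp_periodic (2 * π * Complex.I * w / (1 : ℝ))]
    congr 1
    push_cast
    ring
  have h24 : Periodic.qParam 24 (w + 1) = cexp (2 * π * Complex.I / 24) * Periodic.qParam 24 w := by
    simp only [Periodic.qParam, ← exp_add]
    congr 1
    push_cast
    ring
  simp only [ModularForm.eta, eta_q, h1, h24, mul_assoc]

theorem Delta5_ne_zero (z : ℍ) : Delta5 z ≠ 0 :=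
  mul_ne_zero (pow_ne_zero _ (eta_ne_zero z.2)) (pow_ne_zero _ (eta_ne_zero (scale 5 z).2))

theorem Delta5_pow_six (z : ℍ) :
    Delta5 z ^ 6 = discriminant z * discriminant (scale 5 z) := by
  simp only [Delta5, discriminant, scale]
  push_cast
  ring

theorem mdifferentiable_Delta5 :
    MDifferentiable (modelWithCornersSelf ℂ ℂ) (modelWithCornersSelf ℂ ℂ) Delta5 := by
  rw [UpperHalfPlane.mdifferentiable_iff]
  have h : DifferentiableOn ℂ (fun z : ℂ ↦ η z ^ 4 * η (5 * z) ^ 4) {z | 0 < z.im} := by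
    intro z hz
    have h5 : 0 < (5 * z).im := by simpa using hz
    refine DifferentiableAt.differentiableWithinAt (.mul (.pow ?_ 4) (.pow ?_ 4))
    · exact differentiableAt_eta_of_mem_upperHalfPlaneSet hz
    · exact (differentiableAt_eta_of_mem_upperHalfPlaneSet h5).comp z
        (differentiableAt_id.const_mul 5)
  refine h.congr fun z hz ↦ ?_
  simp [Delta5, ofComplex_apply_of_im_pos hz]

/-- `W 5` exchanges the two eta factors up to the inversion `w ↦ -1/w`; the two minus signs cancel.
-/
theorem Delta5_slash_W : Delta5 ∣[(4 : ℤ)] W 5 = Delta5 := by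
  rw [slash_eq_self_iff_of_det_eq_one (det_W 5)]
  intro z
  have hs : (√5 : ℂ) ^ 2 = 5 := by exact_mod_cast Real.sq_sqrt (by norm_num : (0 : ℝ) ≤ 5)
  have hs0 : (√5 : ℂ) ≠ 0 := by intro h; simp [h] at hs
  have hz : ((W 5 • z : ℍ) : ℂ) = -1 / (5 * z) := by
    rw [coe_smul_of_det_eq_one (det_W 5)]
    have := z.ne_zero
    simp [W_coe]
    field_simp
    linear_combination hs
  have h5 : 0 < (5 * (z : ℂ)).im := by simpa using z.im_pos
  have h5z : 5 * (-1 / (5 * (z : ℂ))) = -1 / z := by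
    have := z.ne_zero
    field_simp
  have hd : denom (W 5) z = √5 * z := by simp [denom, W_coe]
  rw [hd, Delta5, hz, h5z, eta_neg_one_div_pow_four h5, eta_neg_one_div_pow_four z.im_pos, Delta5]
  have h4 : (√5 : ℂ) ^ 4 = 25 := by linear_combination ((√5 : ℂ) ^ 2 + 5) * hs
  rw [zpow_ofNat, mul_pow (√5 : ℂ), h4]
  ring

theorem Delta5_slash_T : Delta5 ∣[(4 : ℤ)] mapGL ℝ ModularGroup.T = Delta5 := by
  rw [slash_eq_self_iff_of_det_eq_one (by simp)]
  intro z
  have hz : ((mapGL ℝ ModularGroup.T • z : ℍ) : ℂ) = z + 1 := by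
    rw [coe_smul_of_det_eq_one (by simp)]
    simp [ModularGroup.coe_T]
  have hd : denom (mapGL ℝ ModularGroup.T) z = 1 := by simp [denom, ModularGroup.coe_T]
  have h24 : cexp (2 * π * Complex.I / 24) ^ 24 = 1 := by
    rw [← exp_nat_mul, ← exp_two_pi_mul_I]
    congr 1
    push_cast
    ring
  -- The factors contribute a 24th root of unity to the powers 4 and 20, in total its 24th power.
  rw [Delta5, Delta5, hz, hd, show 5 * ((z : ℂ) + 1) = 5 * z + 1 + 1 + 1 + 1 + 1 by ring]
  simp only [eta_add_one, _root_.one_zpow, one_mul]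
  linear_combination η z ^ 4 * η (5 * z) ^ 4 * h24

theorem Delta5_smul_pow_six {γ : SL(2, ℤ)} (hγ : γ ∈ Gamma0 5) (z : ℍ) :
    Delta5 (mapGL ℝ γ • z) ^ 6 = (denom (mapGL ℝ γ) z ^ 4 * Delta5 z) ^ 6 := by
  let D : ModularForm 𝒮ℒ 12 := CuspForm.discriminant
  have h1 : discriminant (mapGL ℝ γ • z) = _ :=
    SlashInvariantForm.slash_action_eqn'' D (MonoidHom.mem_range.2 ⟨γ, rfl⟩) z
  have h2 : discriminant (scale 5 (mapGL ℝ γ • z)) = _ := comp_scale_smul D hγ z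
  have hD : ∀ w, D w = discriminant w := fun _ ↦ rfl
  rw [Delta5_pow_six, h1, h2, mul_pow, Delta5_pow_six, hD, hD]
  norm_cast
  ring

/-- An element of `Γ₀(5)` fixing a point with automorphy factor a fourth root of unity fixes
`Δ₅`. -/
theorem Delta5_slash_of_fixed {γ : SL(2, ℤ)} (hγ : γ ∈ Gamma0 5) {z₀ : ℍ}
    (hz₀ : mapGL ℝ γ • z₀ = z₀) (hd : denom (mapGL ℝ γ) z₀ ^ 4 = 1) :
    Delta5 ∣[(4 : ℤ)] mapGL ℝ γ = Delta5 := by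
  rw [slash_eq_self_iff_of_det_eq_one (by simp)]
  -- The ratio is continuous with values in the sixth roots of unity, hence constant on the
  -- connected half-plane, and it equals one at `z₀`.
  let h : ℍ → ℂ := fun z ↦ Delta5 (mapGL ℝ γ • z) / (denom (mapGL ℝ γ) z ^ 4 * Delta5 z)
  have hne : ∀ z : ℍ, denom (mapGL ℝ γ) z ^ 4 * Delta5 z ≠ 0 := fun z ↦
    mul_ne_zero (pow_ne_zero _ (denom_ne_zero _ z)) (Delta5_ne_zero z)
  have hcD : Continuous Delta5 := mdifferentiable_Delta5.continuous
  have hcont : Continuous h := by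
    have h1 : Continuous fun z : ℍ ↦ mapGL ℝ γ • z := continuous_const_smul _
    have h2 : Continuous fun z : ℍ ↦ denom (mapGL ℝ γ) z := by
      simp only [denom]
      fun_prop
    exact (hcD.comp h1).div ((h2.pow 4).mul hcD) hne
  have hpow : ∀ z, h z ^ 6 = 1 := by
    intro z
    rw [div_pow, Delta5_smul_pow_six hγ, div_self (pow_ne_zero _ (hne z))]
  have hfin : (Set.range h).Finite := by
    refine (Polynomial.nthRootsFinset 6 (1 : ℂ)).finite_toSet.subset ?_
    rintro _ ⟨z, rfl⟩
    simp [hpow]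
  have hsub : (Set.range h).Subsingleton :=
    hfin.countable.isTotallyDisconnected _ subset_rfl (isPreconnected_range hcont)
  have h0 : h z₀ = 1 := by
    simp only [h, hz₀, hd, one_mul, div_self (Delta5_ne_zero z₀)]
  intro z
  have := hsub ⟨z, rfl⟩ ⟨z₀, rfl⟩
  rw [h0, div_eq_one_iff_eq (hne z)] at this
  rw [this]
  norm_cast

/-- `Δ₅` is invariant of weight four under `Γ₀*(5)`. -/
theorem Delta5_slash {g : GL (Fin 2) ℝ} (hg : g ∈ Gamma0Star 5) :
    Delta5 ∣[(4 : ℤ)] g = Delta5 := by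
  let H : Subgroup SL(2, ℤ) :=
    { carrier := {γ | Delta5 ∣[(4 : ℤ)] mapGL ℝ γ = Delta5}
      one_mem' := by simp
      mul_mem' := fun {a b} ha hb ↦ by
        simp only [Set.mem_ofPred_eq] at ha hb ⊢
        rw [map_mul, SlashAction.slash_mul, ha, hb]
      inv_mem' := fun {a} ha ↦ by
        simp only [Set.mem_ofPred_eq] at ha ⊢
        conv_lhs => rw [← ha]
        rw [← SlashAction.slash_mul, ← map_mul, mul_inv_cancel, map_one, SlashAction.slash_one] }
  have hH : ∀ γ, γ ∈ H ↔ Delta5 ∣[(4 : ℤ)] mapGL ℝ γ = Delta5 := fun _ ↦ Iff.rfl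
  obtain ⟨V, hV⟩ : ∃ γ : SL(2, ℤ), (γ : Matrix (Fin 2) (Fin 2) ℤ) = !![1, 0; 5, 1] :=
    ⟨⟨_, by simp⟩, rfl⟩
  obtain ⟨e₁, he₁⟩ : ∃ γ : SL(2, ℤ), (γ : Matrix (Fin 2) (Fin 2) ℤ) = !![2, -1; 5, -2] :=
    ⟨⟨_, by simp⟩, rfl⟩
  obtain ⟨e₂, he₂⟩ : ∃ γ : SL(2, ℤ), (γ : Matrix (Fin 2) (Fin 2) ℤ) = !![-2, -1; 5, 2] :=
    ⟨⟨_, by simp⟩, rfl⟩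
  have hTH : ModularGroup.T ∈ H := Delta5_slash_T
  have hVH : V ∈ H := by
    have hs : √(5 : ℝ) * √(5 : ℝ) = 5 := Real.mul_self_sqrt (by norm_num)
    have hs0 : √(5 : ℝ) ≠ 0 := by positivity
    have hTm : (mapGL ℝ ModularGroup.T : Matrix (Fin 2) (Fin 2) ℝ) = !![1, 1; 0, 1] := by
      ext i j
      fin_cases i <;> fin_cases j <;> simp [ModularGroup.coe_T]
    have hVm : (mapGL ℝ V : Matrix (Fin 2) (Fin 2) ℝ) = !![1, 0; 5, 1] := by
      ext i j
      fin_cases i <;> fin_cases j <;> simp [hV]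
    -- That is, `V = W T⁻¹ W⁻¹`, so invariance under `T` and `W` suffices.
    have hVW : mapGL ℝ V * (W 5 * mapGL ℝ ModularGroup.T) = W 5 := by
      ext i j
      fin_cases i <;> fin_cases j <;>
        simp [W_coe, hVm, hTm, -Matrix.SpecialLinearGroup.mapGL_coe_matrix]
      field_simp
      linarith
    have hWT : Delta5 ∣[(4 : ℤ)] (W 5 * mapGL ℝ ModularGroup.T) = Delta5 := by
      rw [SlashAction.slash_mul, Delta5_slash_W, Delta5_slash_T]
    generalize W 5 * mapGL ℝ ModularGroup.T = X at hWT hVW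
    rw [hH, eq_mul_inv_of_mul_eq hVW, SlashAction.slash_mul, Delta5_slash_W]
    conv_lhs => rw [← hWT]
    rw [← SlashAction.slash_mul, mul_inv_cancel, SlashAction.slash_one]
  have hfix : ∀ (γ : SL(2, ℤ)) (ε : ℤ), ε ^ 2 = 1 →
      (γ : Matrix (Fin 2) (Fin 2) ℤ) = !![2 * ε, -1; 5, -(2 * ε)] → γ ∈ H := by
    intro γ ε hε hγ
    have hεC : (ε : ℂ) ^ 2 = 1 := by exact_mod_cast hε
    -- The fixed point of `γ`, a root of `5z² - 4εz + 1`.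
    let z₀ : ℍ := ⟨(2 * ε + Complex.I) / 5, by
      rw [show (2 * (ε : ℂ) + Complex.I) / 5 = ((2 * ε / 5 : ℝ) : ℂ) + ((1 / 5 : ℝ) : ℂ) * Complex.I by
        push_cast; ring]
      simp⟩
    have hz₀ : (z₀ : ℂ) = (2 * ε + Complex.I) / 5 := rfl
    have hden : denom (mapGL ℝ γ) z₀ = Complex.I := by
      simp [denom, hγ, hz₀]
      ring
    refine Delta5_slash_of_fixed (z₀ := z₀) ?_ ?_ (by rw [hden, I_pow_four])
    · rw [Gamma0_mem, hγ]
      exact (ZMod.intCast_zmod_eq_zero_iff_dvd 5 5).2 dvd_rfl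
    · ext
      rw [coe_smul_of_det_eq_one (by simp)]
      change _ / denom (mapGL ℝ γ) z₀ = _
      rw [hden, div_eq_iff I_ne_zero, hz₀]
      simp [hγ]
      linear_combination 4 / 5 * hεC - 1 / 5 * I_sq
  have he₁H : e₁ ∈ H := hfix e₁ 1 (by norm_num) (by simpa using he₁)
  have he₂H : e₂ ∈ H := hfix e₂ (-1) (by norm_num) (by simpa using he₂)
  have hle : Gamma0 5 ≤ H := Gamma0_five_le hV he₁ he₂ hTH hVH he₁H he₂H
  obtain ⟨γ, hγ, rfl | rfl⟩ := hg
  · exact hle hγ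
  · rw [SlashAction.slash_mul, (hH γ).1 (hle hγ), Delta5_slash_W]

end Delta5

end Fricke

namespace Fricke

open scoped ModularForm Real Topology
open Filter Asymptotics ModularForm

theorem im_scale (p : ℕ) [NeZero p] (z : ℍ) : (scale p z).im = p * z.im := by
  change ((p : ℂ) * z).im = _
  simp

theorem tendsto_scale_atImInfty (p : ℕ) [NeZero p] :
    Tendsto (scale p) atImInfty atImInfty := by
  refine tendsto_comap_iff.2 ?_
  have h : im ∘ scale p = fun z ↦ (p : ℝ) * z.im := funext (im_scale p)
  rw [h]
  exact tendsto_comap.const_mul_atTop (Nat.cast_pos.2 (Nat.pos_of_neZero p))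

theorem mdifferentiable_comp_scale {p : ℕ} [NeZero p] {f : ℍ → ℂ}
    (hf : MDifferentiable (modelWithCornersSelf ℂ ℂ) (modelWithCornersSelf ℂ ℂ) f) :
    MDifferentiable (modelWithCornersSelf ℂ ℂ) (modelWithCornersSelf ℂ ℂ) (f ∘ scale p) := by
  rw [UpperHalfPlane.mdifferentiable_iff] at hf ⊢
  have hp : (0 : ℝ) < p := Nat.cast_pos.2 (Nat.pos_of_neZero p)
  have hmaps : Set.MapsTo (fun z : ℂ ↦ (p : ℂ) * z) {z | 0 < z.im} {z | 0 < z.im} := by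
    intro z hz
    simpa using mul_pos hp hz
  refine (hf.comp (differentiable_id.const_mul (p : ℂ)).differentiableOn hmaps).congr ?_
  intro z hz
  have h := hmaps hz
  simp only [Function.comp_apply, ofComplex_apply_of_im_pos hz]
  rw [ofComplex_apply_of_im_pos h]
  rfl

/-! ### Order of `Δ₅` at infinity and division by it. -/

section Delta5

theorem Delta5_pow_six_eq : Delta5 ^ 6 = discriminant * (discriminant ∘ scale 5) :=
  funext Delta5_pow_six

theorem Delta5_isZeroAtImInfty : IsZeroAtImInfty Delta5 := by
  have h : Tendsto (Delta5 ^ 6) atImInfty (𝓝 (0 * 0)) := by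
    rw [Delta5_pow_six_eq]
    exact discriminant_isZeroAtImInfty.mul
      (discriminant_isZeroAtImInfty.comp (tendsto_scale_atImInfty 5))
  rw [mul_zero] at h
  refine (isLittleO_one_iff ℝ).1 (IsLittleO.of_pow (n := 6) ?_ (by norm_num))
  exact ((isLittleO_one_iff ℝ).2 h).congr_right fun _ ↦ by simp

/-- The order of vanishing at infinity is at most one: the sixth power `Δ(z) Δ(5z)` has order `1 + 5
= 6`. -/
theorem exp_isBigO_Delta5 : (fun τ : ℍ ↦ Real.exp (-2 * π * τ.im)) =O[atImInfty] Delta5 := by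
  refine IsBigO.of_pow (n := 6) (by norm_num) ?_
  rw [Delta5_pow_six_eq]
  have h := exp_isBigO_discriminant.mul
    (exp_isBigO_discriminant.comp_tendsto (tendsto_scale_atImInfty 5))
  refine (h.congr_left fun τ ↦ ?_)
  simp only [Function.comp_apply, Pi.pow_apply]
  rw [← Real.exp_add, ← Real.exp_nat_mul]
  congr 1
  rw [im_scale]
  push_cast
  ring

/-- `Δ₅` as a cusp form of weight four for `Γ₀*(5)`. -/
noncomputable def Delta5CuspForm : CuspForm (Gamma0Star 5) 4 where
  toFun := Delta5
  slash_action_eq' _ hg := Delta5_slash hg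
  holo' := mdifferentiable_Delta5
  zero_at_cusps' hc :=
    isZeroAt_of_isZeroAtImInfty (by norm_num) (fun _ ↦ Delta5_slash) Delta5_isZeroAtImInfty hc

variable {k : ℤ}

/-- The quotient of a cusp form for `Γ₀*(5)` by `Δ₅`. -/
noncomputable def divDelta5 (f : CuspForm (Gamma0Star 5) k) :
    ModularForm (Gamma0Star 5) (k - 4) :=
  have hslash : ∀ g ∈ Gamma0Star 5, (fun z ↦ f z / Delta5 z) ∣[k - 4] g =
      fun z ↦ f z / Delta5 z := by
    intro g hg
    have hdet : g.det = 1 := Subgroup.HasDetOne.det_eq hg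
    have hf := (slash_eq_self_iff_of_det_eq_one hdet).1 (f.slash_action_eq' g hg)
    have hD := (slash_eq_self_iff_of_det_eq_one hdet).1 (Delta5_slash hg)
    rw [slash_eq_self_iff_of_det_eq_one hdet]
    intro z
    have := Delta5_ne_zero z
    have hd := denom_ne_zero g z
    rw [show f (g • z) = _ from hf z, hD, zpow_sub₀ hd]
    change _ * f z / _ = _
    field_simp
  { toFun := fun z ↦ f z / Delta5 z
    slash_action_eq' := hslash
    holo' := f.holo'.div mdifferentiable_Delta5 Delta5_ne_zero
    bdd_at_cusps' := fun hc ↦ by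
      refine isBoundedAt_of_isBoundedAtImInfty (by norm_num) hslash ?_ hc
      -- A cusp form is `O(q)`, and `q` is `O(Δ₅)`.
      have h : f =O[atImInfty] Delta5 :=
        (CuspFormClass.exp_decay_atImInfty (h := 1) f one_pos
          one_mem_strictPeriods_Gamma0Star).trans (by simpa using exp_isBigO_Delta5)
      exact (div_isBoundedUnder_of_isBigO h).isBigO_one ℝ }

theorem Delta5_mul_divDelta5 (f : CuspForm (Gamma0Star 5) k) :
    Delta5 * ⇑(divDelta5 f) = f := by
  ext z
  exact mul_div_cancel₀ (f z) (Delta5_ne_zero z)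

theorem setOf_coe_cuspForm_eq :
    {F : ℍ → ℂ | ∃ f ∈ cuspFormSubmodule (Gamma0Star 5) k, ⇑f = F} =
      {F : ℍ → ℂ | ∃ g : ModularForm (Gamma0Star 5) (k - 4), F = Delta5 * ⇑g} := by
  ext F
  constructor
  · rintro ⟨_, ⟨f, rfl⟩, rfl⟩
    exact ⟨divDelta5 f, (Delta5_mul_divDelta5 f).symm⟩
  · rintro ⟨g, rfl⟩
    exact ⟨_, ⟨CuspForm.mcast (by ring) (Delta5CuspForm.mulModularForm g), rfl⟩, rfl⟩

theorem cuspFormSubmodule_eq_bot (h : ∀ g : ModularForm (Gamma0Star 5) (k - 4), g = 0) :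
    cuspFormSubmodule (Gamma0Star 5) k = ⊥ := by
  refine (Submodule.eq_bot_iff _).2 ?_
  rintro _ ⟨f, rfl⟩
  refine DFunLike.coe_injective ?_
  change (f : ℍ → ℂ) = 0
  rw [← Delta5_mul_divDelta5 f, h (divDelta5 f)]
  simp

end Delta5

/-! ### Forms determined by their constant term. -/

section ConstantTerm

variable {k : ℤ} {p : ℕ} [NeZero p]

theorem tendsto_atImInfty_cuspFunction {Γ : Subgroup (GL (Fin 2) ℝ)}
    (hΓ : 1 ∈ Γ.strictPeriods) (f : ModularForm Γ k) :
    Tendsto f atImInfty (𝓝 (cuspFunction 1 f 0)) := by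
  have h := (ModularFormClass.analyticAt_cuspFunction_zero f one_pos hΓ).continuousAt.tendsto.comp
    (qParam_tendsto_atImInfty one_pos)
  exact h.congr fun τ ↦ SlashInvariantFormClass.eq_cuspFunction f τ hΓ one_ne_zero

theorem mem_cuspFormSubmodule_of_isZeroAtImInfty (hp : p.Prime) (f : ModularForm (Gamma0Star p) k)
    (hf : IsZeroAtImInfty f) : f ∈ cuspFormSubmodule (Gamma0Star p) k :=
  (isCuspForm_iff f).2 fun hc ↦ isZeroAt_of_isZeroAtImInfty hp f.slash_action_eq' hf hc

/-- If there are no cusp forms of weight `k`, a form with constant term one is a basis. -/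
theorem exists_basis_of_cuspFormSubmodule_eq_bot (hp : p.Prime)
    (h : cuspFormSubmodule (Gamma0Star p) k = ⊥) (e : ModularForm (Gamma0Star p) k)
    (he : Tendsto e atImInfty (𝓝 1)) :
    Module.finrank ℂ (ModularForm (Gamma0Star p) k) = 1 ∧
      ∃ b : Module.Basis (Fin 1) ℂ (ModularForm (Gamma0Star p) k), b 0 = e := by
  have hne : e ≠ 0 := by
    rintro rfl
    exact one_ne_zero (tendsto_nhds_unique he tendsto_const_nhds)
  have hspan : ∀ f : ModularForm (Gamma0Star p) k, ∃ c : ℂ, c • e = f := by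
    intro f
    refine ⟨cuspFunction 1 f 0, ?_⟩
    have hz : f - cuspFunction 1 f 0 • e ∈ cuspFormSubmodule (Gamma0Star p) k := by
      refine mem_cuspFormSubmodule_of_isZeroAtImInfty hp _ ?_
      have := (tendsto_atImInfty_cuspFunction one_mem_strictPeriods_Gamma0Star f).sub
        (he.const_mul (cuspFunction 1 f 0))
      rwa [mul_one, sub_self] at this
    rw [h, Submodule.mem_bot, sub_eq_zero] at hz
    exact hz.symm
  refine ⟨finrank_eq_one e hne hspan, ⟨.mk (v := fun _ : Fin 1 ↦ e) ?_ ?_, Module.Basis.mk_apply ..⟩⟩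
  · exact LinearIndependent.of_subsingleton 0 hne
  · rintro f -
    obtain ⟨c, rfl⟩ := hspan f
    exact Submodule.smul_mem _ _ (Submodule.subset_span ⟨0, rfl⟩)

end ConstantTerm

/-! ### Fricke symmetrisation and the Eisenstein series of weight six. -/

section Eisenstein

variable {p : ℕ} [NeZero p] {k m : ℤ}

/-- Each summand is invariant under `Γ₀(p)`, and `W p` exchanges them: by level one inversion
`f(Wz)` yields `f(pz)` and `f(pWz)` yields `f(z)`, with weights balanced by `p ^ m`. -/
theorem comp_scale_add_slash (hk : k = 2 * m) (f : ModularForm 𝒮ℒ k) {g : GL (Fin 2) ℝ}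
    (hg : g ∈ Gamma0Star p) :
    (fun z ↦ (p : ℂ) ^ m * f (scale p z) + f z) ∣[k] g =
      fun z ↦ (p : ℂ) ^ m * f (scale p z) + f z := by
  have hΓ : ∀ γ ∈ Gamma0 p, (fun z ↦ (p : ℂ) ^ m * f (scale p z) + f z) ∣[k] mapGL ℝ γ =
      fun z ↦ (p : ℂ) ^ m * f (scale p z) + f z := by
    intro γ hγ
    rw [slash_eq_self_iff_of_det_eq_one (by simp)]
    intro z
    rw [comp_scale_smul f hγ, SlashInvariantForm.slash_action_eqn'' f
      (MonoidHom.mem_range.2 ⟨γ, rfl⟩)]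
    ring
  have hS : ∀ z w : ℍ, (w : ℂ) = -1 / z → f w = (z : ℂ) ^ k * f z := by
    intro z w hw
    have hSm : (mapGL ℝ ModularGroup.S : Matrix (Fin 2) (Fin 2) ℝ) = !![0, -1; 1, 0] := by
      ext i j
      fin_cases i <;> fin_cases j <;> simp [ModularGroup.coe_S]
    have hz : w = mapGL ℝ ModularGroup.S • z := by
      ext
      rw [coe_smul_of_det_eq_one (by simp), hSm, hw]
      simp
    rw [hz, SlashInvariantForm.slash_action_eqn'' f (MonoidHom.mem_range.2 ⟨_, rfl⟩)]
    congr 2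
    simp [denom, hSm, -mapGL_coe_matrix]
  have hW : (fun z ↦ (p : ℂ) ^ m * f (scale p z) + f z) ∣[k] W p =
      fun z ↦ (p : ℂ) ^ m * f (scale p z) + f z := by
    rw [slash_eq_self_iff_of_det_eq_one (det_W p)]
    intro z
    have hp : (p : ℂ) ≠ 0 := Nat.cast_ne_zero.2 (NeZero.ne p)
    have hs : (√(p : ℝ) : ℂ) ^ 2 = p := by
      exact_mod_cast Real.sq_sqrt (Nat.cast_nonneg (α := ℝ) p)
    have hs0 : (√(p : ℝ) : ℂ) ≠ 0 := by
      intro h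
      rw [h] at hs
      exact hp (by rw [← hs]; simp)
    have hz0 := z.ne_zero
    have hz : ((W p • z : ℍ) : ℂ) = -1 / (scale p z : ℂ) := by
      rw [coe_smul_of_det_eq_one (det_W p)]
      simp [W_coe, scale]
      field_simp
      rw [hs]
    have hz' : (scale p (W p • z) : ℂ) = -1 / z := by
      change (p : ℂ) * ((W p • z : ℍ) : ℂ) = _
      rw [hz]
      simp only [scale]
      field_simp
    have hd : denom (W p) z = √(p : ℝ) * z := by simp [denom, W_coe]
    rw [hS _ _ hz, hS _ _ hz', hd, mul_zpow]
    change _ + ((p : ℂ) * z) ^ k * _ = _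
    have hsk : (√(p : ℝ) : ℂ) ^ k = (p : ℂ) ^ m := by
      rw [hk, _root_.zpow_mul, zpow_ofNat, hs]
    have hpk : (p : ℂ) ^ k = (p : ℂ) ^ m * (p : ℂ) ^ m := by rw [hk, two_mul, zpow_add₀ hp]
    rw [mul_zpow, hsk, hpk]
    ring
  obtain ⟨γ, hγ, rfl | rfl⟩ := hg
  · exact hΓ γ hγ
  · rw [SlashAction.slash_mul, hΓ γ hγ, hW]

/-- The Fricke symmetrisation `p^{k/2} f(pz) + f(z)` of a modular form of level one. -/
noncomputable def symmetrization (hp : p.Prime) (hk : k = 2 * m) (f : ModularForm 𝒮ℒ k) :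
    ModularForm (Gamma0Star p) k where
  toFun z := (p : ℂ) ^ m * f (scale p z) + f z
  slash_action_eq' _ hg := comp_scale_add_slash hk f hg
  holo' := ((mdifferentiable_comp_scale f.holo').const_smul ((p : ℂ) ^ m)).add f.holo'
  bdd_at_cusps' hc := by
    refine isBoundedAt_of_isBoundedAtImInfty hp (fun _ hg ↦ comp_scale_add_slash hk f hg) ?_ hc
    have hb : IsBoundedAtImInfty f := ModularFormClass.bdd_at_infty f
    exact ((hb.comp_tendsto (tendsto_scale_atImInfty p)).const_mul_left _).add hb

/-- `E*_{6,5}` as a modular form. -/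
noncomputable def EStarSix : ModularForm (Gamma0Star 5) 6 :=
  (1 / ((5 : ℂ) ^ (3 : ℤ) + 1)) • symmetrization (m := 3) (by norm_num) (by norm_num) E₆

theorem coe_EStarSix : ⇑EStarSix = EStar 5 6 := by
  ext z
  rfl

theorem tendsto_E₆ : Tendsto E₆ atImInfty (𝓝 1) := by
  have h := EisensteinSeries.E_qExpansion_coeff_zero (k := 6) (by norm_num) ⟨3, rfl⟩
  have h2 := tendsto_atImInfty_cuspFunction one_mem_strictPeriods_SL E₆
  simp only [qExpansion_coeff, Nat.factorial_zero, Nat.cast_one, inv_one, one_mul,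
    iteratedDeriv_zero] at h
  rwa [h] at h2

theorem tendsto_EStarSix : Tendsto EStarSix atImInfty (𝓝 1) := by
  have h := (((tendsto_E₆.comp (tendsto_scale_atImInfty 5)).const_mul
    ((5 : ℂ) ^ (3 : ℤ))).add tendsto_E₆).const_mul (1 / ((5 : ℂ) ^ (3 : ℤ) + 1))
  have h1 : 1 / ((5 : ℂ) ^ (3 : ℤ) + 1) * ((5 : ℂ) ^ (3 : ℤ) * 1 + 1) = 1 := by norm_num
  rw [h1] at h
  exact h

end Eisenstein

end Fricke

namespace Fricke

open scoped ModularForm Real Topology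
open Filter ModularForm

/-! ### Primitives of modular forms. -/

section Primitive

/-- A periodic modular form has a primitive whose increment over a period is the constant
term. -/
theorem exists_primitive {Γ : Subgroup (GL (Fin 2) ℝ)} {k : ℤ} (hΓ : 1 ∈ Γ.strictPeriods)
    (f : ModularForm Γ k) :
    ∃ F : ℂ → ℂ, (∀ z : ℍ, HasDerivAt F (f z) z) ∧
      ∀ z : ℂ, F (z + 1) = F z + cuspFunction 1 f 0 := by
  have hdiff : DifferentiableOn ℂ (cuspFunction 1 f) (Metric.ball 0 1) := fun q hq ↦
    (ModularFormClass.differentiableAt_cuspFunction f one_pos hΓ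
      (by simpa using hq)).differentiableWithinAt
  obtain ⟨G, hG⟩ := ((Complex.differentiableOn_dslope
    (Metric.ball_mem_nhds (0 : ℂ) one_pos)).2 hdiff).isExactOn_ball
  have hc : (2 * π * Complex.I : ℂ) ≠ 0 := Complex.two_pi_I_ne_zero
  -- With `q = exp(2πiz)`, `f` is its constant term plus `q` times the `dslope`, whose primitive in
  -- `q` is `G`; since `dq = 2πi q dz`, both terms integrate explicitly.
  refine ⟨fun z ↦ cuspFunction 1 f 0 * z +
    (2 * π * Complex.I)⁻¹ * G (Complex.exp (2 * π * Complex.I * z)), fun z ↦ ?_, fun z ↦ ?_⟩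
  · have hq : Function.Periodic.qParam 1 z = Complex.exp (2 * π * Complex.I * z) := by
      simp [Function.Periodic.qParam]
    have hval : cuspFunction 1 f (Complex.exp (2 * π * Complex.I * z)) = f z := by
      rw [← hq]
      exact SlashInvariantFormClass.eq_cuspFunction f z hΓ one_ne_zero
    set q := Complex.exp (2 * π * Complex.I * z) with hqdef
    have hqb : q ∈ Metric.ball (0 : ℂ) 1 := by
      simpa [hqdef] using norm_exp_two_pi_I_lt_one z
    have hexp : HasDerivAt (fun w : ℂ ↦ Complex.exp (2 * π * Complex.I * w))
        (q * (2 * π * Complex.I)) z := by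
      simpa using ((hasDerivAt_id (z : ℂ)).const_mul (2 * π * Complex.I)).cexp
    have h := ((hasDerivAt_id (z : ℂ)).const_mul (cuspFunction 1 f 0)).add
      (((hG q hqb).comp (z : ℂ) hexp).const_mul (2 * π * Complex.I)⁻¹)
    refine h.congr_deriv ?_
    have hds := sub_smul_dslope (cuspFunction 1 f) 0 q
    rw [sub_zero, smul_eq_mul, hval] at hds
    field_simp
    linear_combination hds
  · have hexp : Complex.exp (2 * π * Complex.I * (z + 1)) =
        Complex.exp (2 * π * Complex.I * z) := by
      rw [mul_add, mul_one, Complex.exp_periodic]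
    simp only [hexp]
    ring

/-- A primitive of a form of weight two is invariant under elliptic elements. -/
theorem primitive_smul_eq {Γ : Subgroup (GL (Fin 2) ℝ)} [Γ.HasDetOne] (f : ModularForm Γ 2)
    {F : ℂ → ℂ} (hF : ∀ z : ℍ, HasDerivAt F (f z) z) {g : GL (Fin 2) ℝ} (hg : g ∈ Γ)
    {z₀ : ℍ} (hz₀ : g • z₀ = z₀) (z : ℍ) : F (g • z : ℍ) = F z := by
  have hdet : g.det = 1 := Subgroup.HasDetOne.det_eq hg
  have hdet' : (g 0 0 : ℂ) * g 1 1 - g 0 1 * g 1 0 = 1 := by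
    have : (g.det : ℝ) = 1 := by rw [hdet]; rfl
    rw [GeneralLinearGroup.val_det_apply, Matrix.det_fin_two] at this
    exact_mod_cast this
  let m : ℂ → ℂ := fun w ↦ (g 0 0 * w + g 0 1) / (g 1 0 * w + g 1 1)
  have hm : ∀ w : ℍ, m w = (g • w : ℍ) := fun w ↦ (coe_smul_of_det_eq_one hdet w).symm
  -- Weight two makes `f dz` invariant, so `F ∘ g - F` is constant; its value at the fixed point is
  -- zero.
  have hder : ∀ w : ℍ, HasDerivAt (fun w ↦ F (m w) - F w) 0 w := by
    intro w
    have hd : (g 1 0 * w + g 1 1 : ℂ) ≠ 0 := denom_ne_zero g w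
    have hm' : HasDerivAt m (1 / (g 1 0 * w + g 1 1 : ℂ) ^ 2) w := by
      have h1 := ((hasDerivAt_id (w : ℂ)).const_mul (g 0 0 : ℂ)).add_const (g 0 1 : ℂ)
      have h2 := ((hasDerivAt_id (w : ℂ)).const_mul (g 1 0 : ℂ)).add_const (g 1 1 : ℂ)
      refine (h1.div h2 hd).congr_deriv ?_
      simp only [id, mul_one]
      congr 1
      linear_combination hdet'
    have hF' : HasDerivAt F (f (g • w)) (m w) := hm w ▸ hF (g • w)
    refine ((hF'.comp (w : ℂ) hm').sub (hF w)).congr_deriv ?_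
    rw [SlashInvariantForm.slash_action_eqn'' f hg]
    change (g 1 0 * w + g 1 1 : ℂ) ^ (2 : ℤ) * f w * _ - f w = 0
    rw [zpow_ofNat]
    field_simp
    ring
  have hconst := isOpen_upperHalfPlaneSet.is_const_of_deriv_eq_zero
    (convex_halfSpace_im_gt 0).isPreconnected
    (fun w hw ↦ (hder ⟨w, hw⟩).differentiableAt.differentiableWithinAt)
    (fun w hw ↦ (hder ⟨w, hw⟩).deriv) z.2 z₀.2
  simp only [hm, hz₀, sub_self] at hconst
  exact sub_eq_zero.1 hconst

end Primitive

/-! ### Vanishing in weight two. -/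

section WeightTwo

/-- Forms of weight two for `Γ₀*(5)` have vanishing constant term, because the translation by one
is a product of elliptic elements of `Γ₀*(5)`. -/
theorem cuspFunction_zero_of_weight_two (f : ModularForm (Gamma0Star 5) 2) :
    cuspFunction 1 f 0 = 0 := by
  obtain ⟨F, hF, hF1⟩ := exists_primitive one_mem_strictPeriods_Gamma0Star f
  have hs : (√5 : ℂ) * √5 = 5 := by exact_mod_cast Real.mul_self_sqrt (by norm_num : (0 : ℝ) ≤ 5)
  have hs0 : (√5 : ℂ) ≠ 0 := by intro h; simp [h] at hs
  obtain ⟨e, he⟩ : ∃ γ : SL(2, ℤ), (γ : Matrix (Fin 2) (Fin 2) ℤ) = !![2, -1; 5, -2] :=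
    ⟨⟨_, by simp⟩, rfl⟩
  have heΓ : e ∈ Gamma0 5 := by
    rw [Gamma0_mem, he]
    exact (ZMod.intCast_zmod_eq_zero_iff_dvd 5 5).2 dvd_rfl
  obtain ⟨δ, hδ⟩ : ∃ γ : SL(2, ℤ), (γ : Matrix (Fin 2) (Fin 2) ℤ) = !![-3, 1; 5, -2] :=
    ⟨⟨_, by simp⟩, rfl⟩
  have hδΓ : δ ∈ Gamma0 5 := by
    rw [Gamma0_mem, hδ]
    exact (ZMod.intCast_zmod_eq_zero_iff_dvd 5 5).2 dvd_rfl
  have hTδ : ModularGroup.T * δ = e := by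
    ext i j
    fin_cases i <;> fin_cases j <;>
      simp [ModularGroup.coe_T, hδ, he]
  -- Since `δ = T⁻¹ e`, this gives `T w = e W` with `w` of trace zero; `W`, `e` and `w` fix `z₁`,
  -- `z₂` and `z₃` respectively.
  obtain ⟨w, hwdef⟩ : ∃ w, w = mapGL ℝ δ * W 5 := ⟨_, rfl⟩
  have hw : w ∈ Gamma0Star 5 := ⟨δ, hδΓ, Or.inr hwdef⟩
  have hwm : (w : Matrix (Fin 2) (Fin 2) ℝ) = !![√5, 3 / √5; -2 * √5, -√5] := by
    rw [hwdef]
    ext i j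
    fin_cases i <;> fin_cases j <;> simp [W_coe, Matrix.mul_apply, Fin.sum_univ_two, hδ] <;>
      field_simp <;> norm_num
  let z₁ : ℍ := ⟨Complex.I / √5, by
    rw [show Complex.I / √5 = ((1 / √5 : ℝ) : ℂ) * Complex.I by push_cast; ring]
    simp⟩
  let z₂ : ℍ := ⟨(2 + Complex.I) / 5, by
    rw [show (2 + Complex.I) / 5 = ((2 / 5 : ℝ) : ℂ) + ((1 / 5 : ℝ) : ℂ) * Complex.I by
      push_cast; ring]
    simp⟩
  let z₃ : ℍ := ⟨(-1 + Complex.I / √5) / 2, by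
    rw [show (-1 + Complex.I / √5) / 2 =
      ((-1 / 2 : ℝ) : ℂ) + ((1 / (2 * √5) : ℝ) : ℂ) * Complex.I by push_cast; field_simp]
    simp⟩
  have hz₁ : (z₁ : ℂ) = Complex.I / √5 := rfl
  have hz₂ : (z₂ : ℂ) = (2 + Complex.I) / 5 := rfl
  have hz₃ : (z₃ : ℂ) = (-1 + Complex.I / √5) / 2 := rfl
  have h₁ : W 5 • z₁ = z₁ := by
    ext
    rw [coe_smul_of_det_eq_one (det_W 5), hz₁]
    simp [W_coe]
    field_simp
    linear_combination -Complex.I_sq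
  have h₂ : mapGL ℝ e • z₂ = z₂ := by
    have hd : 5 * (z₂ : ℂ) + -2 = Complex.I := by rw [hz₂]; ring
    ext
    rw [coe_smul_of_det_eq_one (by simp)]
    simp only [mapGL_coe_matrix, map_apply_coe, RingHom.mapMatrix_apply, Matrix.map_apply]
    simp only [he]
    simp
    rw [hd, div_eq_iff Complex.I_ne_zero, hz₂]
    linear_combination -1 / 5 * Complex.I_sq
  have h₃ : w • z₃ = z₃ := by
    have hd : -(2 * (√5 : ℂ) * z₃) + -√5 = -Complex.I := by
      rw [hz₃]
      field_simp
      ring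
    ext
    rw [coe_smul_of_det_eq_one (Subgroup.HasDetOne.det_eq hw), hwm]
    simp
    rw [hd, div_eq_iff (neg_ne_zero.2 Complex.I_ne_zero), hz₃]
    field_simp
    linear_combination -hs + Complex.I_sq
  have hTw : mapGL ℝ ModularGroup.T * w = mapGL ℝ e * W 5 := by
    rw [hwdef, ← mul_assoc, ← map_mul, hTδ]
  have hT : ((mapGL ℝ ModularGroup.T • w • z₁ : ℍ) : ℂ) = (w • z₁ : ℍ) + 1 := by
    rw [coe_smul_of_det_eq_one (by simp)]
    simp [ModularGroup.coe_T]
  -- `F` has the same value at `w z₁` and at `T w z₁ = e W z₁`, so its increment over a period is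
  -- zero.
  have key : F ((w • z₁ : ℍ) + 1) = F z₁ := by
    rw [← hT, ← mul_smul, hTw, mul_smul,
      primitive_smul_eq f hF (mapGL_mem_Gamma0Star heΓ) h₂,
      primitive_smul_eq f hF W_mem_Gamma0Star h₁]
  rw [hF1, primitive_smul_eq f hF hw h₃] at key
  simpa using key

theorem eq_zero_of_weight_two (f : ModularForm (Gamma0Star 5) 2) : f = 0 := by
  have hz : IsZeroAtImInfty f := by
    have h := tendsto_atImInfty_cuspFunction one_mem_strictPeriods_Gamma0Star f
    rwa [cuspFunction_zero_of_weight_two] at h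
  have hf := mem_cuspFormSubmodule_of_isZeroAtImInfty (by norm_num) f hz
  rwa [cuspFormSubmodule_eq_bot fun g ↦ isZero_of_neg_weight (by norm_num) g,
    Submodule.mem_bot] at hf

end WeightTwo

end Fricke

theorem mainTheorem10 (k : ℤ) (hk : Even k) :
    ((k < 0 ∨ k = 2) → ∀ f : ModularForm (Fricke.Gamma0Star 5) k, f = 0) ∧
    ((k = 0 ∨ k = 6) →
      ModularForm.cuspFormSubmodule (Fricke.Gamma0Star 5) k = ⊥ ∧
      Module.finrank ℂ (ModularForm (Fricke.Gamma0Star 5) k) = 1 ∧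
      ∃ b : Module.Basis (Fin 1) ℂ (ModularForm (Fricke.Gamma0Star 5) k),
        ⇑(b 0) = Fricke.EStar 5 k) ∧
    {F : ℍ → ℂ | ∃ f ∈ ModularForm.cuspFormSubmodule (Fricke.Gamma0Star 5) k, ⇑f = F} =
      {F : ℍ → ℂ | ∃ g : ModularForm (Fricke.Gamma0Star 5) (k - 4), F = Fricke.Delta5 * ⇑g} := by
  refine ⟨?_, ?_, Fricke.setOf_coe_cuspForm_eq⟩
  · rintro (h | rfl) f
    · exact ModularForm.isZero_of_neg_weight h f
    · exact Fricke.eq_zero_of_weight_two f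
  · rintro (rfl | rfl)
    · have hbot := Fricke.cuspFormSubmodule_eq_bot (k := 0) fun g ↦
        ModularForm.isZero_of_neg_weight (by norm_num) g
      obtain ⟨hfin, b, hb⟩ := Fricke.exists_basis_of_cuspFormSubmodule_eq_bot (by norm_num) hbot
        (ModularForm.const 1) tendsto_const_nhds
      refine ⟨hbot, hfin, b, ?_⟩
      rw [hb]
      ext z
      norm_num [Fricke.EStar, Fricke.E]
    · have hbot := Fricke.cuspFormSubmodule_eq_bot (k := 6) fun g ↦
        Fricke.eq_zero_of_weight_two g
      obtain ⟨hfin, b, hb⟩ := Fricke.exists_basis_of_cuspFormSubmodule_eq_bot (by norm_num) hbot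
        Fricke.EStarSix Fricke.tendsto_EStarSix
      exact ⟨hbot, hfin, b, by rw [hb, Fricke.coe_EStarSix]⟩
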